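/- Let $n \ge 1$ and let $f_1,\dots,f_n : [0,\infty) \to [0,\infty)$ be convex, (strictly) increasing functions with $f_i(0)=0$. Let $$K = \Big\{x \in \mathbb{R}^n : \sum_{i=1}^n f_i(|x_i|) \le 1\Big\}$$ be the corresponding generalized Orlicz ball, and suppose that $K$ is in isotropic position, i.e. $K$ has Lebesgue volume $1$ and there is a constant $L_K > 0$ such that $\int_K \langle \theta, x\rangle^2\,dx = L_K^2$ for every unit vector $\theta \in \mathbb{R}^n$. Let $X$ be a random vector uniformly distributed on $K$. Then $|X|^2$ (where $|\cdot|$ is the Euclidean norm) has finite variance, and $$\sigma_K := \sqrt{\frac{\operatorname{Var}(|X|^2)}{n L_K^4}} \le \sqrt5 .$$ -/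

import Mathlib

open MeasureTheory ProbabilityTheory

/-- A Young function: a convex, increasing function on `[0, ∞)` that vanishes at `0`.
It is represented by a function on `ℝ` of which only the values on `[0, ∞)` matter; these are
automatically nonnegative. -/
structure IsYoungFunction (f : ℝ → ℝ) : Prop where
  convexOn : ConvexOn ℝ (Set.Ici 0) f
  strictMonoOn : StrictMonoOn f (Set.Ici 0)
  map_zero : f 0 = 0

/-- The set of points `x` of `ℝⁿ` such that `∑ i, f i |x i| ≤ 1`. -/
def generalizedOrliczBall {n : ℕ} (f : Fin n → ℝ → ℝ) : Set (EuclideanSpace ℝ (Fin n)) :=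
  {x | ∑ i, f i |x i| ≤ 1}

/-- `K` is a generalized Orlicz ball: it is given by some family of Young functions. -/
def IsGeneralizedOrliczBall {n : ℕ} (K : Set (EuclideanSpace ℝ (Fin n))) : Prop :=
  ∃ f : Fin n → ℝ → ℝ, (∀ i, IsYoungFunction (f i)) ∧ K = generalizedOrliczBall f

/-- `K` is in isotropic position with isotropic constant `L`: it has volume one, and the second
moment of its uniform distribution in each direction `θ` of the unit sphere equals `L ^ 2`. -/
structure IsIsotropic {n : ℕ} (K : Set (EuclideanSpace ℝ (Fin n))) (L : ℝ) : Prop where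
  volume_eq_one : volume K = 1
  pos : 0 < L
  second_moment : ∀ θ : EuclideanSpace ℝ (Fin n), ‖θ‖ = 1 →
    ∫ x in K, (inner ℝ θ x) ^ 2 = L ^ 2

/-- The parameter `σ_K = (Var (|X|²) / (n L⁴)) ^ (1/2)`, where `X` has the law
`volume.restrict K`, the uniform distribution on a body `K` of volume one. -/
noncomputable def sigmaParam {n : ℕ} (K : Set (EuclideanSpace ℝ (Fin n))) (L : ℝ) : ℝ :=
  √(variance (fun x : EuclideanSpace ℝ (Fin n) => ‖x‖ ^ 2) (volume.restrict K) / (n * L ^ 4))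

/-! `Var |X|²` is the sum of all covariances of `X i ^ 2` and `X j ^ 2`. The off-diagonal ones are
nonpositive, and each diagonal one is at most `6 L⁴ - L⁴ = 5 L⁴`.

Both bounds rest on one fact: the volume `V s` of `{∑ f i |z i| ≤ s}` is log-concave in `s`
(`volume_orliczSublevel_logConcave`), by Prékopa–Leindler and induction on dimension. Fixing a
coordinate `x i = t` leaves a sublevel set of the other coordinates at level `s - f i |t|`, so the
marginals inherit log-concavity.

Diagonal: a marginal is even and log-concave, and `fourth_moment_le` compares it with a two-sided
exponential, for which the constant is `6`.

Off-diagonal: log-concavity and Chebyshev's inequality make the mean of `x j ^ 2` nondecreasing in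
the level. A larger `|x i|` lowers the level of the slice and hence that mean, so a second use of
Chebyshev gives negative correlation. -/

/-! ### Chebyshev's association inequality. -/

/-- A weighted Chebyshev association inequality: if the ratio `q / p` is nonincreasing in the
weight `w`, then `w` and `q / p` are negatively correlated under `p`. -/
lemma lintegral_mul_mul_lintegral_le {α : Type*} [MeasurableSpace α] {μ : Measure α}
    {w p q : α → ENNReal} (hw : Measurable w) (hp : Measurable p)
    (hq : Measurable q) (h : ∀ y y', w y ≤ w y' → q y' * p y ≤ q y * p y') :
    (∫⁻ y, w y * q y ∂μ) * ∫⁻ y, p y ∂μ ≤ (∫⁻ y, w y * p y ∂μ) * ∫⁻ y, q y ∂μ := by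
  -- Symmetrised integrand: integrating over `y` and `y'` gives twice each side of the claim. With
  -- `w y' = w y + δ` the terms in `w y` agree, leaving `δ` times the hypothesis.
  have point : ∀ y y', w y ≤ w y' →
      w y * q y * p y' + p y * (w y' * q y') ≤ w y * p y * q y' + q y * (w y' * p y') := by
    intro y y' hyy
    obtain ⟨δ, hδ⟩ := exists_add_of_le hyy
    rw [hδ]
    calc w y * q y * p y' + p y * ((w y + δ) * q y')
        = w y * (q y * p y' + p y * q y') + δ * (q y' * p y) := by ring
      _ ≤ w y * (q y * p y' + p y * q y') + δ * (q y * p y') := by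
          exact add_le_add_right (mul_le_mul_right (h y y' hyy) δ) _
      _ = _ := by ring
  have point' : ∀ y y',
      w y * q y * p y' + p y * (w y' * q y') ≤ w y * p y * q y' + q y * (w y' * p y') := by
    intro y y'
    rcases le_total (w y) (w y') with hh | hh
    · exact point y y' hh
    · have := point y' y hh
      calc _ = w y' * q y' * p y + p y' * (w y * q y) := by ring
        _ ≤ _ := this
        _ = _ := by ring
  have expand : ∀ f g : α → ENNReal, Measurable f → Measurable g →
      ∫⁻ y, ∫⁻ y', (w y * f y * g y' + g y * (w y' * f y')) ∂μ ∂μ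
        = 2 * ((∫⁻ y, w y * f y ∂μ) * ∫⁻ y, g y ∂μ) := by
    intro f g hf hg
    have h1 : ∀ y, ∫⁻ y', (w y * f y * g y' + g y * (w y' * f y')) ∂μ
        = w y * f y * ∫⁻ y', g y' ∂μ + g y * ∫⁻ y', w y' * f y' ∂μ := by
      intro y
      rw [lintegral_add_left (by fun_prop), lintegral_const_mul _ hg,
        lintegral_const_mul _ (by fun_prop)]
    simp_rw [h1]
    rw [lintegral_add_left (by fun_prop), lintegral_mul_const _ (by fun_prop),
      lintegral_mul_const _ (by fun_prop)]
    ring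
  have key := lintegral_mono (μ := μ) fun y => lintegral_mono (μ := μ) (point' y)
  rw [expand q p hq hp, expand p q hp hq] at key
  exact (ENNReal.mul_le_mul_iff_right (by simp) (by simp)).1 key

/-! ### Brunn–Minkowski and Prékopa–Leindler on the line. -/

/-- The one-dimensional Brunn–Minkowski inequality, for a set that contains the symmetric intervals
spanned by the convex combinations of the absolute values. -/
lemma volume_convexCombination_le {A B C : Set ℝ} {μ : ℝ} (h0 : 0 < μ) (h1 : μ < 1)
    (hA : A.Nonempty) (hB : B.Nonempty)
    (h : ∀ x ∈ A, ∀ y ∈ B, ∀ z, |z| ≤ (1 - μ) * |x| + μ * |y| → z ∈ C) :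
    ENNReal.ofReal (1 - μ) * volume A + ENNReal.ofReal μ * volume B ≤ volume C := by
  have h1' : 0 < 1 - μ := by linarith
  rcases eq_or_ne (volume C) ⊤ with hC | hC
  · simp [hC]
  set v := (volume C).toReal with hv
  have hvC : volume C = ENNReal.ofReal v := (ENNReal.ofReal_toReal hC).symm
  -- `C` contains a symmetric interval for each pair. Fixing `y` bounds the volume of `A`; that
  -- volume then replaces `2 * |x|` and the same argument bounds `B`. No measurability is needed.
  have hball : ∀ x ∈ A, ∀ y ∈ B, 2 * ((1 - μ) * |x| + μ * |y|) ≤ v := by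
    intro x hx y hy
    have hsub : Set.Icc (-((1 - μ) * |x| + μ * |y|)) ((1 - μ) * |x| + μ * |y|) ⊆ C :=
      fun z hz => h x hx y hy z (abs_le.2 hz)
    have := measure_mono (μ := volume) hsub
    rw [Real.volume_Icc, hvC, ENNReal.ofReal_le_ofReal_iff (by simp [hv])] at this
    linarith
  have bound : ∀ (S : Set ℝ) (R : ℝ), (∀ x ∈ S, 2 * |x| ≤ R) → volume S ≤ ENNReal.ofReal R := by
    intro S R hS
    have hsub : S ⊆ Set.Icc (-(R / 2)) (R / 2) :=
      fun x hx => abs_le.1 (by linarith [hS x hx])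
    refine (measure_mono hsub).trans ?_
    rw [Real.volume_Icc]
    exact ENNReal.ofReal_le_ofReal (by linarith)
  obtain ⟨x₀, hx₀⟩ := hA
  obtain ⟨y₀, hy₀⟩ := hB
  have hAy : ∀ y ∈ B, volume A ≤ ENNReal.ofReal ((v - 2 * μ * |y|) / (1 - μ)) := by
    intro y hy
    refine bound A _ fun x hx => ?_
    rw [le_div_iff₀ h1']
    linarith [hball x hx y hy]
  have hAfin : volume A ≠ ⊤ := ((hAy y₀ hy₀).trans_lt ENNReal.ofReal_lt_top).ne
  set a := (volume A).toReal with ha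
  have hvA : volume A = ENNReal.ofReal a := (ENNReal.ofReal_toReal hAfin).symm
  have hAy' : ∀ y ∈ B, (1 - μ) * a + 2 * μ * |y| ≤ v := by
    intro y hy
    have hpos : 0 ≤ (v - 2 * μ * |y|) / (1 - μ) := by
      apply div_nonneg _ h1'.le
      have := hball x₀ hx₀ y hy
      have : 0 ≤ (1 - μ) * |x₀| := by positivity
      linarith
    have := hAy y hy
    rw [hvA, ENNReal.ofReal_le_ofReal_iff hpos, le_div_iff₀ h1'] at this
    linarith
  have hB' : volume B ≤ ENNReal.ofReal ((v - (1 - μ) * a) / μ) := by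
    refine bound B _ fun y hy => ?_
    rw [le_div_iff₀ h0]
    linarith [hAy' y hy]
  have ha0 : 0 ≤ a := by simp [ha]
  calc _ ≤ ENNReal.ofReal (1 - μ) * ENNReal.ofReal a
        + ENNReal.ofReal μ * ENNReal.ofReal ((v - (1 - μ) * a) / μ) := by
          rw [hvA]; gcongr
    _ = ENNReal.ofReal v := by
      have h2 : 0 ≤ (v - (1 - μ) * a) := by
        have := hAy' y₀ hy₀
        have : 0 ≤ 2 * μ * |y₀| := by positivity
        linarith
      rw [← ENNReal.ofReal_mul h1'.le, ← ENNReal.ofReal_mul h0.le,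
        ← ENNReal.ofReal_add (by positivity) (by positivity)]
      congr 1
      field_simp
      ring
    _ = volume C := hvC.symm

/-- The one-dimensional Prékopa–Leindler inequality for functions with maximum `1` at the origin. -/
lemma lintegral_convexCombination_le {F H h : ℝ → ℝ} {μ : ℝ} (h0 : 0 < μ) (h1 : μ < 1)
    (mF : Measurable F) (mH : Measurable H) (mh : Measurable h)
    (nF : ∀ x, 0 ≤ F x) (nH : ∀ x, 0 ≤ H x) (nh : ∀ x, 0 ≤ h x)
    (F0 : F 0 = 1) (H0 : H 0 = 1) (F1 : ∀ x, F x ≤ 1) (H1 : ∀ x, H x ≤ 1)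
    (hc : ∀ x y z, |z| ≤ (1 - μ) * |x| + μ * |y| → F x ^ (1 - μ) * H y ^ μ ≤ h z) :
    ENNReal.ofReal (1 - μ) * (∫⁻ x, ENNReal.ofReal (F x))
      + ENNReal.ofReal μ * (∫⁻ x, ENNReal.ofReal (H x)) ≤ ∫⁻ x, ENNReal.ofReal (h x) := by
  have h1' : 0 < 1 - μ := by linarith
  have anti : ∀ f : ℝ → ℝ, Measurable fun t : ℝ => volume {a | t < f a} := by
    intro f
    apply Antitone.measurable
    intro s t hst
    exact measure_mono fun a (ha : t < f a) => lt_of_le_of_lt hst ha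
  rw [lintegral_eq_lintegral_meas_lt _ (.of_forall nF) mF.aemeasurable,
    lintegral_eq_lintegral_meas_lt _ (.of_forall nH) mH.aemeasurable,
    lintegral_eq_lintegral_meas_lt _ (.of_forall nh) mh.aemeasurable,
    ← lintegral_const_mul _ (anti F), ← lintegral_const_mul _ (anti H),
    ← lintegral_add_left ((anti F).const_mul _)]
  refine setLIntegral_mono (anti h) fun t ht => ?_
  have ht0 : 0 < t := ht
  -- Below level `1` both superlevel sets contain `0`, hence are nonempty; from level `1` on they
  -- are empty.
  rcases lt_or_ge t 1 with ht1 | ht1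
  · refine volume_convexCombination_le h0 h1 ⟨0, by simpa [F0]⟩ ⟨0, by simpa [H0]⟩ ?_
    intro x hx y hy z hz
    have hx : t < F x := hx
    have hy : t < H y := hy
    refine lt_of_lt_of_le ?_ (hc x y z hz)
    calc t = t ^ (1 - μ) * t ^ μ := by
          rw [← Real.rpow_add ht0]; simp
      _ < F x ^ (1 - μ) * H y ^ μ := by
          apply mul_lt_mul'' <;> first | positivity | exact Real.rpow_lt_rpow ht0.le ‹_› ‹_›
  · have e1 : {a | t < F a} = ∅ := by
      ext a; simpa using (F1 a).trans ht1
    have e2 : {a | t < H a} = ∅ := by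
      ext a; simpa using (H1 a).trans ht1
    simp [e1, e2]

/-- The one-dimensional Prékopa–Leindler inequality for functions with a maximum at the origin. -/
lemma rpow_integral_mul_rpow_integral_le {F H h : ℝ → ℝ} {μ : ℝ} (h0 : 0 < μ) (h1 : μ < 1)
    (mF : Measurable F) (mH : Measurable H) (mh : Measurable h)
    (iF : Integrable F) (iH : Integrable H) (ih : Integrable h)
    (nF : ∀ x, 0 ≤ F x) (nH : ∀ x, 0 ≤ H x) (nh : ∀ x, 0 ≤ h x)
    (F1 : ∀ x, F x ≤ F 0) (H1 : ∀ x, H x ≤ H 0)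
    (hc : ∀ x y z, |z| ≤ (1 - μ) * |x| + μ * |y| → F x ^ (1 - μ) * H y ^ μ ≤ h z) :
    (∫ x, F x) ^ (1 - μ) * (∫ x, H x) ^ μ ≤ ∫ x, h x := by
  have h1' : 0 < 1 - μ := by linarith
  have hI : 0 ≤ ∫ x, h x := integral_nonneg nh
  rcases (nF 0).eq_or_lt with hF0 | hF0
  · have : F = 0 := funext fun x => le_antisymm ((F1 x).trans hF0.ge) (nF x)
    simpa [this, Real.zero_rpow h1'.ne'] using hI
  rcases (nH 0).eq_or_lt with hH0 | hH0
  · have : H = 0 := funext fun x => le_antisymm ((H1 x).trans hH0.ge) (nH x)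
    simpa [this, Real.zero_rpow h0.ne'] using hI
  -- Both maxima are scaled to `1`; the resulting arithmetic-mean bound is then weakened to the
  -- geometric mean.
  set c := F 0 ^ (1 - μ) * H 0 ^ μ with hcdef
  have hc0 : 0 < c := by positivity
  have key := lintegral_convexCombination_le (F := fun x => F x / F 0) (H := fun x => H x / H 0)
    (h := fun x => h x / c) h0 h1 (by fun_prop) (by fun_prop) (by fun_prop)
    (fun x => div_nonneg (nF x) hF0.le) (fun x => div_nonneg (nH x) hH0.le)
    (fun x => div_nonneg (nh x) hc0.le) (div_self hF0.ne') (div_self hH0.ne')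
    (fun x => (div_le_one hF0).2 (F1 x)) (fun x => (div_le_one hH0).2 (H1 x))
    (by
      intro x y z hz
      rw [Real.div_rpow (nF x) hF0.le, Real.div_rpow (nH y) hH0.le, div_mul_div_comm]
      exact div_le_div_of_nonneg_right (hc x y z hz) hc0.le)
  rw [← ofReal_integral_eq_lintegral_ofReal (iF.div_const _)
      (.of_forall fun x => div_nonneg (nF x) hF0.le),
    ← ofReal_integral_eq_lintegral_ofReal (iH.div_const _)
      (.of_forall fun x => div_nonneg (nH x) hH0.le),
    ← ofReal_integral_eq_lintegral_ofReal (ih.div_const _)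
      (.of_forall fun x => div_nonneg (nh x) hc0.le),
    integral_div, integral_div, integral_div,
    ← ENNReal.ofReal_mul h1'.le, ← ENNReal.ofReal_mul h0.le] at key
  have hFI : 0 ≤ ∫ x, F x := integral_nonneg nF
  have hHI : 0 ≤ ∫ x, H x := integral_nonneg nH
  rw [← ENNReal.ofReal_add (by positivity) (by positivity),
    ENNReal.ofReal_le_ofReal_iff (by positivity)] at key
  have amgm := Real.geom_mean_le_arith_mean2_weighted h1'.le h0.le
    (div_nonneg hFI hF0.le) (div_nonneg hHI hH0.le) (by ring)
  have := amgm.trans key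
  rw [Real.div_rpow hFI hF0.le, Real.div_rpow hHI hH0.le, div_mul_div_comm,
    div_le_div_iff_of_pos_right hc0] at this
  exact this

/-! ### Fourth moments of even log-concave densities. -/

/-- The even moments of the two-sided exponential distribution. -/
lemma integral_pow_mul_exp_neg_mul_abs {r : ℝ} (hr : 0 < r) {k : ℕ} (hk : Even k) :
    Integrable (fun t : ℝ => t ^ k * Real.exp (-(r * |t|))) ∧
      ∫ t : ℝ, t ^ k * Real.exp (-(r * |t|)) = 2 * (k.factorial / r ^ (k + 1)) := by
  have e : (fun t : ℝ => t ^ k * Real.exp (-(r * |t|)))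
      = fun t : ℝ => |t| ^ k * Real.exp (-(r * |t|)) := by
    funext t; rw [hk.pow_abs]
  have hI : ∫ t in Set.Ioi (0 : ℝ), t ^ k * Real.exp (-(r * t)) = k.factorial / r ^ (k + 1) := by
    have := Real.integral_rpow_mul_exp_neg_mul_Ioi (a := (k : ℝ) + 1) (r := r) (by positivity) hr
    rw [Real.Gamma_nat_eq_factorial] at this
    simp only [add_sub_cancel_right, Real.rpow_natCast] at this
    rw [this]
    rw [show (k : ℝ) + 1 = ((k + 1 : ℕ) : ℝ) by push_cast; rfl, Real.rpow_natCast, one_div, inv_pow]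
    field_simp
  rw [e]
  have hval : ∫ t : ℝ, |t| ^ k * Real.exp (-(r * |t|)) = 2 * (k.factorial / r ^ (k + 1)) := by
    rw [integral_comp_abs (f := fun t => t ^ k * Real.exp (-(r * t))), hI]
  refine ⟨?_, hval⟩
  -- A non-integrable function has integral `0` by convention, but the computed value is positive.
  by_contra hni
  rw [integral_undef hni] at hval
  have : 0 < 2 * ((k.factorial : ℝ) / r ^ (k + 1)) := by positivity
  linarith

/-- Among even log-concave densities of bounded support, the fourth moment is at most that of
the two-sided exponential density with the same mass and second moment. -/
lemma fourth_moment_le {g : ℝ → ℝ} (hm : Measurable g) (hg0 : ∀ t, 0 ≤ g t)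
    (hgM : ∀ t, g t ≤ g 0) {R : ℝ} (hR : ∀ t, R < |t| → g t = 0) (heven : ∀ t, g |t| = g t)
    (hlog : ∀ x y μ, 0 < μ → μ < 1 → g x ^ (1 - μ) * g y ^ μ ≤ g ((1 - μ) * x + μ * y))
    (h0 : 0 < ∫ t, g t) (h2 : 0 < ∫ t, t ^ 2 * g t) :
    (∫ t, t ^ 4 * g t) * ∫ t, g t ≤ 6 * (∫ t, t ^ 2 * g t) ^ 2 := by
  have hint : ∀ k : ℕ, Integrable fun t => t ^ k * g t := by
    intro k
    have : (fun t => t ^ k * g t) = Set.indicator (Set.Icc (-R) R) fun t => t ^ k * g t := by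
      funext t
      by_cases ht : t ∈ Set.Icc (-R) R
      · simp [ht]
      · rw [Set.indicator_of_notMem ht, hR t, mul_zero]
        by_contra hh
        exact ht (abs_le.1 (not_lt.1 hh))
    rw [this, integrable_indicator_iff measurableSet_Icc]
    refine Measure.integrableOn_of_bounded (M := R ^ k * g 0) (by simp) (by fun_prop) ?_
    refine (ae_restrict_iff' measurableSet_Icc).2 (.of_forall fun t ht => ?_)
    rw [norm_mul, norm_pow, Real.norm_eq_abs, Real.norm_eq_abs, abs_of_nonneg (hg0 t)]
    have : |t| ≤ R := abs_le.2 ht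
    have hRn : 0 ≤ R := (abs_nonneg t).trans this
    exact mul_le_mul (pow_le_pow_left₀ (abs_nonneg t) this k) (hgM t) (hg0 t) (by positivity)
  set M0 := ∫ t, g t
  set M2 := ∫ t, t ^ 2 * g t
  -- The density `c * exp (-r |t|)` has mass `2c/r`, second moment `4c/r³` and fourth moment
  -- `48c/r⁵`. Matching the first two to `M0` and `M2` fixes `r` and `c`, and makes the last `6 *
  -- M2² / M0`.
  set r := √(2 * M0 / M2) with hr
  have hr0 : 0 < r := Real.sqrt_pos.2 (by positivity)
  have hr2 : r ^ 2 = 2 * M0 / M2 := Real.sq_sqrt (by positivity)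
  set c := r * M0 / 2 with hc
  have hc0 : 0 < c := by positivity
  set e : ℝ → ℝ := fun t => c * Real.exp (-(r * |t|)) with he
  have hepos : ∀ t, 0 < e t := fun t => by positivity
  have hemom : ∀ k : ℕ, Even k → Integrable (fun t => t ^ k * e t) ∧
      ∫ t, t ^ k * e t = c * (2 * (k.factorial / r ^ (k + 1))) := by
    intro k hk
    obtain ⟨hi, hv⟩ := integral_pow_mul_exp_neg_mul_abs hr0 hk
    have : (fun t => t ^ k * e t) = fun t => c * (t ^ k * Real.exp (-(r * |t|))) := by
      funext t; simp only [he]; ring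
    rw [this, integral_const_mul, hv]
    exact ⟨hi.const_mul c, rfl⟩
  have e0 : ∫ t, e t = M0 := by
    have := (hemom 0 (by decide)).2
    simp only [pow_zero, one_mul, Nat.factorial_zero, Nat.cast_one, zero_add, pow_one] at this
    rw [this, hc]; field_simp
  have e2 : ∫ t, t ^ 2 * e t = M2 := by
    rw [(hemom 2 (by decide)).2, hc]
    have : r ^ (2 + 1) = r * (2 * M0 / M2) := by rw [← hr2]; ring
    rw [this]
    norm_num [Nat.factorial]
    field_simp
  have e4 : (∫ t, t ^ 4 * e t) * M0 = 6 * M2 ^ 2 := by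
    rw [(hemom 4 (by decide)).2, hc]
    have : r ^ (4 + 1) = r * (2 * M0 / M2) ^ 2 := by rw [← hr2]; ring
    rw [this]
    norm_num [Nat.factorial]
    field_simp
    norm_num
  -- the set where the density exceeds the exponential is an interval
  set S : Set ℝ := {t | 0 ≤ t ∧ e t ≤ g t} with hS
  have hSR : ∀ t ∈ S, t ≤ R := by
    intro t ht
    by_contra hh
    have := hR t (lt_of_lt_of_le (not_le.1 hh) (le_abs_self t))
    linarith [ht.2, hepos t]
  -- On `[0, ∞)` the logarithm of `e` is affine, while that of `g` is concave.
  have hSc : ∀ x ∈ S, ∀ z ∈ S, ∀ y, x < y → y < z → y ∈ S := by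
    intro x hx z hz y hxy hyz
    have hzx : 0 < z - x := by linarith
    refine ⟨hx.1.trans hxy.le, ?_⟩
    set μ := (y - x) / (z - x) with hμ
    have hμ0 : 0 < μ := div_pos (by linarith) hzx
    have hμ1 : μ < 1 := (div_lt_one hzx).2 (by linarith)
    have hy : (1 - μ) * x + μ * z = y := by rw [hμ]; field_simp; ring
    have hμ1' : 0 < 1 - μ := by linarith
    have hl := hlog x z μ hμ0 hμ1
    rw [hy] at hl
    refine le_trans ?_ hl
    calc e y = e x ^ (1 - μ) * e z ^ μ := by
          simp only [he]
          rw [Real.mul_rpow hc0.le (Real.exp_pos _).le, Real.mul_rpow hc0.le (Real.exp_pos _).le,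
            ← Real.exp_mul, ← Real.exp_mul, mul_mul_mul_comm, ← Real.rpow_add hc0,
            ← Real.exp_add, sub_add_cancel, Real.rpow_one, abs_of_nonneg hx.1,
            abs_of_nonneg hz.1, abs_of_nonneg (hx.1.trans hxy.le), ← hy]
          ring_nf
      _ ≤ g x ^ (1 - μ) * g z ^ μ := by
          exact mul_le_mul (Real.rpow_le_rpow (hepos x).le hx.2 hμ1'.le)
            (Real.rpow_le_rpow (hepos z).le hz.2 hμ0.le) (Real.rpow_nonneg (hepos z).le _)
            (Real.rpow_nonneg (hg0 x) _)
  -- `p` and `q` are the endpoints of `S`: the polynomial changes sign where `g - e` does. Whether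
  -- the endpoints belong to `S` is immaterial, since the polynomial vanishes there.
  obtain ⟨p, q, hpq⟩ : ∃ p q : ℝ, ∀ t, 0 ≤ t → (t ^ 2 - p ^ 2) * (t ^ 2 - q ^ 2) * (g t - e t) ≤ 0 := by
    rcases S.eq_empty_or_nonempty with hE | hN
    · refine ⟨0, 0, fun t ht => ?_⟩
      have : g t < e t := by
        by_contra hh
        have : t ∈ S := ⟨ht, not_lt.1 hh⟩
        simp [hE] at this
      have : 0 ≤ (t ^ 2 - 0 ^ 2) * (t ^ 2 - 0 ^ 2) := mul_self_nonneg _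
      nlinarith
    · have hbb : BddBelow S := ⟨0, fun t ht => ht.1⟩
      have hba : BddAbove S := ⟨R, fun t ht => hSR t ht⟩
      have hp0 : 0 ≤ sInf S := le_csInf hN fun t ht => ht.1
      have hq0 : 0 ≤ sSup S := by
        obtain ⟨t, ht⟩ := hN
        exact ht.1.trans (le_csSup hba ht)
      have hpq0 : sInf S ≤ sSup S := csInf_le_csSup hN hbb hba
      refine ⟨sInf S, sSup S, fun t ht => ?_⟩
      have out : (t < sInf S ∨ sSup S < t) → g t - e t ≤ 0 := by
        intro hh
        have : t ∉ S := by
          intro hts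
          rcases hh with hh | hh
          · exact absurd (csInf_le hbb hts) (not_le.2 hh)
          · exact absurd (le_csSup hba hts) (not_le.2 hh)
        by_contra h3
        exact this ⟨ht, by linarith⟩
      rcases lt_trichotomy t (sInf S) with h | h | h
      · apply mul_nonpos_of_nonneg_of_nonpos _ (out (Or.inl h))
        exact mul_nonneg_of_nonpos_of_nonpos (by nlinarith) (by nlinarith)
      · simp [h]
      rcases lt_trichotomy t (sSup S) with h' | h' | h'
      · obtain ⟨x, hx, hxt⟩ := exists_lt_of_csInf_lt hN h
        obtain ⟨z, hz, htz⟩ := exists_lt_of_lt_csSup hN h'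
        have hts := (hSc x hx z hz t hxt htz).2
        apply mul_nonpos_of_nonpos_of_nonneg _ (by linarith)
        exact mul_nonpos_of_nonneg_of_nonpos (by nlinarith) (by nlinarith)
      · simp [h']
      · apply mul_nonpos_of_nonneg_of_nonpos _ (out (Or.inr h'))
        exact mul_nonneg (by nlinarith) (by nlinarith)
  have hpq' : ∀ t, (t ^ 2 - p ^ 2) * (t ^ 2 - q ^ 2) * (g t - e t) ≤ 0 := by
    intro t
    have := hpq |t| (abs_nonneg t)
    simpa [heven, he] using this
  have hle : ∫ t, (t ^ 2 - p ^ 2) * (t ^ 2 - q ^ 2) * (g t - e t) ≤ 0 :=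
    integral_nonpos hpq'
  have i0 : Integrable g := by simpa using hint 0
  have j0 : Integrable e := by simpa using (hemom 0 (by decide)).1
  have j2 := (hemom 2 (by decide)).1
  have j4 := (hemom 4 (by decide)).1
  -- The `t²` and constant terms cancel by the matched moments, so only the fourth moments remain.
  have split : ∫ t, (t ^ 2 - p ^ 2) * (t ^ 2 - q ^ 2) * (g t - e t)
      = ((∫ t, t ^ 4 * g t) - ∫ t, t ^ 4 * e t)
        - (p ^ 2 + q ^ 2) * (M2 - ∫ t, t ^ 2 * e t) + p ^ 2 * q ^ 2 * (M0 - ∫ t, e t) := by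
    have : (fun t => (t ^ 2 - p ^ 2) * (t ^ 2 - q ^ 2) * (g t - e t)) = fun t =>
        (t ^ 4 * g t - t ^ 4 * e t) - (p ^ 2 + q ^ 2) * (t ^ 2 * g t - t ^ 2 * e t)
          + p ^ 2 * q ^ 2 * (g t - e t) := by funext t; ring
    rw [this, integral_add, integral_sub, integral_sub (hint 4) j4, integral_const_mul,
      integral_sub (hint 2) j2, integral_const_mul, integral_sub i0 j0]
    · exact (hint 4).sub j4
    · exact ((hint 2).sub j2).const_mul _
    · exact ((hint 4).sub j4).sub (((hint 2).sub j2).const_mul _)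
    · exact (i0.sub j0).const_mul _
  rw [split, e0, e2] at hle
  rw [← e4]
  exact mul_le_mul_of_nonneg_right (by linarith) h0.le

/-! ### Young functions. -/

namespace IsYoungFunction

variable {f : ℝ → ℝ}

lemma monotoneOn (hf : IsYoungFunction f) : MonotoneOn f (Set.Ici 0) :=
  hf.strictMonoOn.monotoneOn

lemma nonneg (hf : IsYoungFunction f) {t : ℝ} (ht : 0 ≤ t) : 0 ≤ f t := by
  simpa [hf.map_zero] using hf.monotoneOn (Set.mem_Ici.2 le_rfl) ht ht

lemma mono_abs (hf : IsYoungFunction f) {x y : ℝ} (h : |x| ≤ |y|) : f |x| ≤ f |y| :=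
  hf.monotoneOn (abs_nonneg x) (abs_nonneg y) h

lemma measurable_comp_abs (hf : IsYoungFunction f) : Measurable fun t => f |t| := by
  have hmono : Monotone fun t => f (max 0 t) := fun s t hst =>
    hf.monotoneOn (Set.mem_Ici.2 (le_max_left _ _)) (Set.mem_Ici.2 (le_max_left _ _))
      (max_le_max le_rfl hst)
  simpa [Function.comp_def] using
    hmono.measurable.comp (measurable_id.abs : Measurable fun t : ℝ => |t|)

lemma abs_convexCombination_le (hf : IsYoungFunction f) {μ x y z : ℝ} (h0 : 0 ≤ μ) (h1 : μ ≤ 1)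
    (hz : |z| ≤ (1 - μ) * |x| + μ * |y|) : f |z| ≤ (1 - μ) * f |x| + μ * f |y| :=
  (hf.monotoneOn (abs_nonneg z) ((abs_nonneg z).trans hz) hz).trans
    (hf.convexOn.2 (abs_nonneg x) (abs_nonneg y) (by linarith) h0 (by ring))

/-- Convexity and `f 0 = 0` give `f 1 * |t| ≤ f |t|` for `|t| ≥ 1`, and strictness gives `f 1 > 0`.
This makes the sublevel sets bounded. -/
lemma abs_le_of_map_le (hf : IsYoungFunction f) {s t : ℝ} (h : f |t| ≤ s) :
    |t| ≤ max 1 (s / f 1) := by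
  have h1 : 0 < f 1 := by
    simpa [hf.map_zero] using hf.strictMonoOn (Set.mem_Ici.2 le_rfl) (Set.mem_Ici.2 zero_le_one)
      zero_lt_one
  rcases le_total |t| 1 with ht | ht
  · exact ht.trans (le_max_left _ _)
  · refine le_trans ?_ (le_max_right _ _)
    rw [le_div_iff₀ h1]
    have h0 : 0 < |t| := by linarith
    have := hf.convexOn.2 (Set.mem_Ici.2 le_rfl) (Set.mem_Ici.2 (abs_nonneg t))
      (sub_nonneg.2 (inv_le_one_of_one_le₀ ht)) (inv_nonneg.2 h0.le) (sub_add_cancel _ _)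
    simp only [smul_eq_mul, mul_zero, zero_add, hf.map_zero, inv_mul_cancel₀ h0.ne'] at this
    rw [inv_mul_eq_div, le_div_iff₀ h0] at this
    linarith

end IsYoungFunction

/-! ### Sublevel sets of Orlicz sums. -/

/-- The set of points `z` with `∑ i, f i |z i| ≤ s`, as a subset of a plain product. -/
def orliczSublevel {m : ℕ} (f : Fin m → ℝ → ℝ) (s : ℝ) : Set (Fin m → ℝ) :=
  {z | ∑ i, f i |z i| ≤ s}

section Sublevel

variable {m : ℕ} {f : Fin m → ℝ → ℝ}

lemma measurable_orliczSum (hf : ∀ i, IsYoungFunction (f i)) :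
    Measurable fun z : Fin m → ℝ => ∑ i, f i |z i| :=
  Finset.measurable_sum _ fun i _ => (hf i).measurable_comp_abs.comp (measurable_pi_apply i)

lemma measurableSet_orliczSublevel (hf : ∀ i, IsYoungFunction (f i)) (s : ℝ) :
    MeasurableSet (orliczSublevel f s) :=
  measurable_orliczSum hf measurableSet_Iic

lemma orliczSublevel_mono (f : Fin m → ℝ → ℝ) : Monotone (orliczSublevel f) :=
  fun _ _ hst _ hz => le_trans hz hst

lemma abs_le_of_mem_orliczSublevel (hf : ∀ i, IsYoungFunction (f i)) {s : ℝ} {z : Fin m → ℝ}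
    (hz : z ∈ orliczSublevel f s) (i : Fin m) : |z i| ≤ max 1 (s / f i 1) :=
  (hf i).abs_le_of_map_le <| (Finset.single_le_sum (f := fun i => f i |z i|)
    (fun j _ => (hf j).nonneg (abs_nonneg _)) (Finset.mem_univ i)).trans hz

lemma volume_orliczSublevel_lt_top (hf : ∀ i, IsYoungFunction (f i)) (s : ℝ) :
    volume (orliczSublevel f s) < ⊤ := by
  have hsub : orliczSublevel f s ⊆
      Set.Icc (fun i => -max 1 (s / f i 1)) (fun i => max 1 (s / f i 1)) := by
    intro z hz
    have h i := abs_le.1 (abs_le_of_mem_orliczSublevel hf hz i)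
    exact ⟨fun i => (h i).1, fun i => (h i).2⟩
  exact (measure_mono hsub).trans_lt isCompact_Icc.measure_lt_top

lemma volumeReal_orliczSublevel_mono (hf : ∀ i, IsYoungFunction (f i)) :
    Monotone fun s => volume.real (orliczSublevel f s) :=
  fun _ t hst => measureReal_mono (orliczSublevel_mono f hst) (volume_orliczSublevel_lt_top hf t).ne

lemma ofReal_volumeReal_orliczSublevel (hf : ∀ i, IsYoungFunction (f i)) (s : ℝ) :
    ENNReal.ofReal (volume.real (orliczSublevel f s)) = volume (orliczSublevel f s) :=
  ENNReal.ofReal_toReal (volume_orliczSublevel_lt_top hf s).ne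

/-- Slice levels `s - f i |t|` become negative for large `|t|`, so the marginal densities have
bounded support. -/
lemma volume_orliczSublevel_of_neg (hf : ∀ i, IsYoungFunction (f i)) {s : ℝ} (hs : s < 0) :
    volume.real (orliczSublevel f s) = 0 := by
  have : orliczSublevel f s = ∅ := by
    refine Set.eq_empty_of_forall_notMem fun z hz => ?_
    have h0 : 0 ≤ ∑ i, f i |z i| := Finset.sum_nonneg fun i _ => (hf i).nonneg (abs_nonneg _)
    exact absurd (h0.trans hz) (not_le.2 hs)
  simp [this]

end Sublevel

/-! ### Slicing along a coordinate. -/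

section Slice

variable {m : ℕ} {f : Fin (m + 1) → ℝ → ℝ}

/-- Integration over a sublevel set by slicing along the `i`-th coordinate. -/
lemma lintegral_orliczSublevel_slice (hf : ∀ i, IsYoungFunction (f i)) (i : Fin (m + 1)) (s : ℝ)
    {Φ : ℝ → ENNReal} {Ψ : (Fin m → ℝ) → ENNReal} (hΦ : Measurable Φ) (hΨ : Measurable Ψ) :
    ∫⁻ x in orliczSublevel f s, Φ (x i) * Ψ (fun j => x (i.succAbove j))
      = ∫⁻ t, Φ t * ∫⁻ z in orliczSublevel (fun j => f (i.succAbove j)) (s - f i |t|), Ψ z := by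
  have hf' : ∀ j, IsYoungFunction (f (i.succAbove j)) := fun j => hf _
  set A : Set (ℝ × (Fin m → ℝ)) := {p | f i |p.1| + ∑ j, f (i.succAbove j) |p.2 j| ≤ s} with hA
  have mA : MeasurableSet A :=
    (((hf i).measurable_comp_abs.comp measurable_fst).add
      ((measurable_orliczSum hf').comp measurable_snd)) measurableSet_Iic
  set F : ℝ × (Fin m → ℝ) → ENNReal := A.indicator fun p => Φ p.1 * Ψ p.2 with hF
  have mF : Measurable F := Measurable.indicator (by fun_prop) mA
  have hpre : ∀ x : Fin (m + 1) → ℝ, x ∈ orliczSublevel f s ↔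
      MeasurableEquiv.piFinSuccAbove (fun _ => ℝ) i x ∈ A := by
    intro x
    change ∑ k, f k |x k| ≤ s ↔ f i |x i| + ∑ j, f (i.succAbove j) |x (i.succAbove j)| ≤ s
    rw [Fin.sum_univ_succAbove _ i]
  rw [← lintegral_indicator (measurableSet_orliczSublevel hf s)]
  have e1 : ∀ x : Fin (m + 1) → ℝ, (orliczSublevel f s).indicator
      (fun x => Φ (x i) * Ψ (fun j => x (i.succAbove j))) x
        = F (MeasurableEquiv.piFinSuccAbove (fun _ => ℝ) i x) := by
    intro x
    by_cases hx : x ∈ orliczSublevel f s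
    · rw [Set.indicator_of_mem hx, hF, Set.indicator_of_mem ((hpre x).1 hx)]
      rfl
    · rw [Set.indicator_of_notMem hx, hF, Set.indicator_of_notMem (fun h => hx ((hpre x).2 h))]
  simp_rw [e1]
  rw [(volume_preserving_piFinSuccAbove (fun _ => ℝ) i).lintegral_comp mF, Measure.volume_eq_prod,
    lintegral_prod _ mF.aemeasurable]
  refine lintegral_congr fun t => ?_
  rw [← lintegral_indicator (measurableSet_orliczSublevel hf' _),
    ← lintegral_const_mul _ (hΨ.indicator (measurableSet_orliczSublevel hf' _))]
  refine lintegral_congr fun z => ?_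
  have hz : (t, z) ∈ A ↔ z ∈ orliczSublevel (fun j => f (i.succAbove j)) (s - f i |t|) := by
    change f i |t| + _ ≤ s ↔ _ ≤ s - f i |t|
    rw [le_sub_iff_add_le']
  by_cases h : (t, z) ∈ A
  · rw [hF, Set.indicator_of_mem h, Set.indicator_of_mem (hz.1 h)]
  · rw [hF, Set.indicator_of_notMem h, Set.indicator_of_notMem (fun h' => h (hz.2 h')), mul_zero]

lemma lintegral_orliczSublevel_coord (hf : ∀ i, IsYoungFunction (f i)) (i : Fin (m + 1)) (s : ℝ)
    {Φ : ℝ → ENNReal} (hΦ : Measurable Φ) :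
    ∫⁻ x in orliczSublevel f s, Φ (x i)
      = ∫⁻ t, Φ t * volume (orliczSublevel (fun j => f (i.succAbove j)) (s - f i |t|)) := by
  simpa using lintegral_orliczSublevel_slice hf i s hΦ (measurable_const (a := (1 : ENNReal)))

lemma volume_orliczSublevel_eq_lintegral (hf : ∀ i, IsYoungFunction (f i)) (i : Fin (m + 1))
    (s : ℝ) : volume (orliczSublevel f s)
      = ∫⁻ t, volume (orliczSublevel (fun j => f (i.succAbove j)) (s - f i |t|)) := by
  simpa using lintegral_orliczSublevel_coord hf i s (measurable_const (a := (1 : ENNReal)))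

/-- The density at `t` of the `i`-th coordinate on a sublevel set: the volume of the slice. -/
noncomputable def sliceVolume (f : Fin (m + 1) → ℝ → ℝ) (i : Fin (m + 1)) (s t : ℝ) : ℝ :=
  volume.real (orliczSublevel (fun j => f (i.succAbove j)) (s - f i |t|))

lemma sliceVolume_nonneg (i : Fin (m + 1)) (s t : ℝ) : 0 ≤ sliceVolume f i s t :=
  measureReal_nonneg

lemma ofReal_sliceVolume (hf : ∀ i, IsYoungFunction (f i)) (i : Fin (m + 1)) (s t : ℝ) :
    ENNReal.ofReal (sliceVolume f i s t)
      = volume (orliczSublevel (fun j => f (i.succAbove j)) (s - f i |t|)) :=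
  ofReal_volumeReal_orliczSublevel (fun _ => hf _) _

lemma measurable_sliceVolume (hf : ∀ i, IsYoungFunction (f i)) (i : Fin (m + 1)) (s : ℝ) :
    Measurable (sliceVolume f i s) :=
  (volumeReal_orliczSublevel_mono fun _ => hf _).measurable.comp
    (measurable_const.sub (hf i).measurable_comp_abs)

lemma sliceVolume_anti (hf : ∀ i, IsYoungFunction (f i)) (i : Fin (m + 1)) (s : ℝ) {x y : ℝ}
    (h : |x| ≤ |y|) : sliceVolume f i s y ≤ sliceVolume f i s x :=
  volumeReal_orliczSublevel_mono (fun _ => hf _) (by linarith [(hf i).mono_abs h])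

/-- Evenness of `k` makes both integrands nonnegative, so the identity passes through `lintegral`
without integrability. -/
lemma setIntegral_orliczSublevel_pow (hf : ∀ i, IsYoungFunction (f i)) (i : Fin (m + 1)) (s : ℝ)
    {k : ℕ} (hk : Even k) :
    ∫ x in orliczSublevel f s, x i ^ k = ∫ t, t ^ k * sliceVolume f i s t := by
  rw [integral_eq_lintegral_of_nonneg_ae (.of_forall fun x => hk.pow_nonneg _)
      ((measurable_pi_apply i).pow_const k).aestronglyMeasurable,
    integral_eq_lintegral_of_nonneg_ae
      (.of_forall fun t => mul_nonneg (hk.pow_nonneg _) (sliceVolume_nonneg i s t))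
      (((measurable_id' (α := ℝ)).pow_const k).mul
        (measurable_sliceVolume hf i s)).aestronglyMeasurable,
    lintegral_orliczSublevel_coord hf i s (Φ := fun t => ENNReal.ofReal (t ^ k)) (by fun_prop)]
  simp_rw [ENNReal.ofReal_mul (hk.pow_nonneg _), ofReal_sliceVolume hf]

lemma integral_sliceVolume (hf : ∀ i, IsYoungFunction (f i)) (i : Fin (m + 1)) (s : ℝ) :
    Integrable (sliceVolume f i s) ∧
      ∫ t, sliceVolume f i s t = volume.real (orliczSublevel f s) := by
  have h : ∫⁻ t, ENNReal.ofReal (sliceVolume f i s t) = volume (orliczSublevel f s) := by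
    simp_rw [ofReal_sliceVolume hf]
    exact (volume_orliczSublevel_eq_lintegral hf i s).symm
  have hm := (measurable_sliceVolume hf i s).aestronglyMeasurable (μ := volume)
  have hn : 0 ≤ᵐ[volume] sliceVolume f i s := .of_forall (sliceVolume_nonneg i s)
  refine ⟨⟨hm, ?_⟩, ?_⟩
  · rw [hasFiniteIntegral_iff_ofReal hn, h]
    exact volume_orliczSublevel_lt_top hf s
  · rw [integral_eq_lintegral_of_nonneg_ae hn hm, h]
    rfl

end Slice

/-! ### Log-concavity in the level. -/

/-- The volume of the sublevel sets is a log-concave function of the level. -/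
lemma volume_orliczSublevel_logConcave {m : ℕ} {f : Fin m → ℝ → ℝ}
    (hf : ∀ i, IsYoungFunction (f i)) {μ : ℝ} (h0 : 0 < μ) (h1 : μ < 1) (a d : ℝ) :
    volume.real (orliczSublevel f a) ^ (1 - μ) * volume.real (orliczSublevel f d) ^ μ
      ≤ volume.real (orliczSublevel f ((1 - μ) * a + μ * d)) := by
  have h1' : 0 < 1 - μ := by linarith
  induction m generalizing a d with
  -- The space is a single point of mass one, so the volume is the indicator of nonnegative levels.
  | zero =>
    rcases lt_or_ge a 0 with ha | ha
    · rw [volume_orliczSublevel_of_neg hf ha, Real.zero_rpow h1'.ne', zero_mul]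
      exact measureReal_nonneg
    rcases lt_or_ge d 0 with hd | hd
    · rw [volume_orliczSublevel_of_neg hf hd, Real.zero_rpow h0.ne', mul_zero]
      exact measureReal_nonneg
    have huniv : ∀ s : ℝ, 0 ≤ s → orliczSublevel f s = Set.univ := fun s hs => by
      ext z; simpa [orliczSublevel] using hs
    rw [huniv a ha, huniv d hd, huniv _ (by positivity)]
    simp [measureReal_def, Measure.volume_pi_eq_dirac (default : Fin 0 → ℝ)]
  | succ m ih =>
    have hf' : ∀ j, IsYoungFunction (f ((0 : Fin (m + 1)).succAbove j)) := fun _ => hf _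
    -- By convexity of `f 0`, the slice level at `z` is at least the convex combination of those at
    -- `x` and `y`, and the induction hypothesis applies.
    have key := rpow_integral_mul_rpow_integral_le h0 h1
      (measurable_sliceVolume hf 0 a) (measurable_sliceVolume hf 0 d)
      (measurable_sliceVolume hf 0 ((1 - μ) * a + μ * d))
      (integral_sliceVolume hf 0 a).1 (integral_sliceVolume hf 0 d).1
      (integral_sliceVolume hf 0 _).1
      (sliceVolume_nonneg 0 a) (sliceVolume_nonneg 0 d) (sliceVolume_nonneg 0 _)
      (fun x => sliceVolume_anti hf 0 a (by simp)) (fun x => sliceVolume_anti hf 0 d (by simp))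
      (by
        intro x y z hz
        refine (ih hf' _ _).trans (volumeReal_orliczSublevel_mono hf' ?_)
        have := (hf 0).abs_convexCombination_le h0.le h1.le hz
        linarith)
    rwa [(integral_sliceVolume hf 0 _).2, (integral_sliceVolume hf 0 _).2,
      (integral_sliceVolume hf 0 _).2] at key

/-- Log-concavity of the volume of the sublevel sets, in four-point form. -/
lemma volume_orliczSublevel_mul_le {m : ℕ} {f : Fin m → ℝ → ℝ}
    (hf : ∀ i, IsYoungFunction (f i)) {a b c d : ℝ} (h : a + d = b + c) (hb : d ≤ b) (hc : d ≤ c) :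
    volume (orliczSublevel f a) * volume (orliczSublevel f d)
      ≤ volume (orliczSublevel f b) * volume (orliczSublevel f c) := by
  rcases hb.eq_or_lt with rfl | hb
  · obtain rfl : c = a := by linarith
    rw [mul_comm]
  rcases hc.eq_or_lt with rfl | hc
  · obtain rfl : b = a := by linarith
    rfl
  have had : 0 < a - d := by linarith
  -- `b` and `c` divide the segment from `a` to `d` with complementary weights; the two
  -- log-concavity bounds are multiplied.
  set μ := (a - b) / (a - d) with hμ
  have hμ0 : 0 < μ := div_pos (by linarith) had
  have hμ1 : μ < 1 := (div_lt_one had).2 (by linarith)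
  have e1 : (1 - μ) * a + μ * d = b := by rw [hμ]; field_simp; ring
  have e2 : (1 - (1 - μ)) * a + (1 - μ) * d = c := by linarith
  have k1 := volume_orliczSublevel_logConcave hf hμ0 hμ1 a d
  have k2 := volume_orliczSublevel_logConcave hf (μ := 1 - μ) (by linarith) (by linarith) a d
  rw [e1] at k1
  rw [e2] at k2
  simp_rw [← ofReal_volumeReal_orliczSublevel hf]
  rw [← ENNReal.ofReal_mul measureReal_nonneg, ← ENNReal.ofReal_mul measureReal_nonneg]
  refine ENNReal.ofReal_le_ofReal ?_
  set A := volume.real (orliczSublevel f a)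
  set D := volume.real (orliczSublevel f d)
  have hA : 0 ≤ A := measureReal_nonneg
  have hD : 0 ≤ D := measureReal_nonneg
  have hsplit : ∀ x : ℝ, 0 ≤ x → x ^ (1 - μ) * x ^ μ = x := fun x hx => by
    rw [← Real.rpow_add' hx (by simp)]; simp
  calc A * D = (A ^ (1 - μ) * D ^ μ) * (A ^ (1 - (1 - μ)) * D ^ (1 - μ)) := by
        nth_rewrite 1 [← hsplit A hA, ← hsplit D hD]
        rw [sub_sub_cancel]; ring
    _ ≤ _ := mul_le_mul k1 k2 (by positivity) measureReal_nonneg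

/-! ### Negative correlation and moment bounds on sublevel sets. -/

lemma abs_le_abs_of_ofReal_sq_le {x y : ℝ} (h : ENNReal.ofReal (x ^ 2) ≤ ENNReal.ofReal (y ^ 2)) :
    |x| ≤ |y| :=
  sq_le_sq.1 ((ENNReal.ofReal_le_ofReal_iff (sq_nonneg y)).1 h)

/-- The mean square of a coordinate on a sublevel set is a nondecreasing function of the level. -/
lemma lintegral_sq_mul_volume_le {m : ℕ} {f : Fin (m + 1) → ℝ → ℝ}
    (hf : ∀ i, IsYoungFunction (f i)) (j : Fin (m + 1)) {s s' : ℝ} (hs : s' ≤ s) :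
    (∫⁻ x in orliczSublevel f s', ENNReal.ofReal (x j ^ 2)) * volume (orliczSublevel f s)
      ≤ (∫⁻ x in orliczSublevel f s, ENNReal.ofReal (x j ^ 2)) * volume (orliczSublevel f s') := by
  have hw : Measurable fun t : ℝ => ENNReal.ofReal (t ^ 2) := by fun_prop
  have hm : ∀ s, Measurable fun t =>
      volume (orliczSublevel (fun k => f (j.succAbove k)) (s - f j |t|)) := fun s => by
    simp_rw [← ofReal_sliceVolume hf]
    exact (measurable_sliceVolume hf j s).ennreal_ofReal
  rw [lintegral_orliczSublevel_coord hf j s' hw, lintegral_orliczSublevel_coord hf j s hw,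
    volume_orliczSublevel_eq_lintegral hf j s, volume_orliczSublevel_eq_lintegral hf j s']
  -- By the four-point inequality, the ratio of the slice volume at level `s'` to that at level `s`
  -- is nonincreasing in `|t|`.
  refine lintegral_mul_mul_lintegral_le hw (hm s) (hm s') fun y y' hyy => ?_
  have := (hf j).mono_abs (abs_le_abs_of_ofReal_sq_le hyy)
  rw [mul_comm]
  exact volume_orliczSublevel_mul_le (fun _ => hf _) (by ring) (by linarith) (by linarith)

/-- The square negative correlation property. -/
lemma lintegral_sq_mul_sq_mul_volume_le {m : ℕ} {f : Fin (m + 1) → ℝ → ℝ}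
    (hf : ∀ i, IsYoungFunction (f i)) {i j : Fin (m + 1)} (hij : i ≠ j) (s : ℝ) :
    (∫⁻ x in orliczSublevel f s, ENNReal.ofReal (x i ^ 2) * ENNReal.ofReal (x j ^ 2))
        * volume (orliczSublevel f s)
      ≤ (∫⁻ x in orliczSublevel f s, ENNReal.ofReal (x i ^ 2))
        * ∫⁻ x in orliczSublevel f s, ENNReal.ofReal (x j ^ 2) := by
  obtain ⟨k, rfl⟩ := Fin.exists_succAbove_eq hij.symm
  obtain _ | m := m
  · exact k.elim0
  have hf' : ∀ l, IsYoungFunction (f (i.succAbove l)) := fun _ => hf _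
  have hw : Measurable fun t : ℝ => ENNReal.ofReal (t ^ 2) := by fun_prop
  have hwk : Measurable fun z : Fin (m + 1) → ℝ => ENNReal.ofReal (z k ^ 2) := by fun_prop
  have hp : Measurable fun t =>
      volume (orliczSublevel (fun l => f (i.succAbove l)) (s - f i |t|)) := by
    simp_rw [← ofReal_sliceVolume hf]
    exact (measurable_sliceVolume hf i s).ennreal_ofReal
  have hq : Measurable fun t => ∫⁻ z in orliczSublevel (fun l => f (i.succAbove l)) (s - f i |t|),
      ENNReal.ofReal (z k ^ 2) := by
    have hmono : Monotone fun s => ∫⁻ z in orliczSublevel (fun l => f (i.succAbove l)) s,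
        ENNReal.ofReal (z k ^ 2) := fun s t hst =>
      lintegral_mono_set (orliczSublevel_mono _ hst)
    exact hmono.measurable.comp (measurable_const.sub (hf i).measurable_comp_abs)
  have e1 := lintegral_orliczSublevel_slice hf i s hw hwk
  have e2 := lintegral_orliczSublevel_slice hf i s (measurable_const (a := (1 : ENNReal))) hwk
  simp only [one_mul] at e2
  rw [e1, e2, lintegral_orliczSublevel_coord hf i s hw, volume_orliczSublevel_eq_lintegral hf i s]
  -- Here the ratio is the mean square of the other coordinate on the slice, and the slice level
  -- falls as `|t|` grows.
  refine lintegral_mul_mul_lintegral_le hw hp hq fun y y' hyy => ?_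
  have := (hf i).mono_abs (abs_le_abs_of_ofReal_sq_le hyy)
  exact lintegral_sq_mul_volume_le hf' k (by linarith)

/-- The fourth moment of a coordinate is controlled by the second moment. -/
lemma setIntegral_pow_four_mul_volume_le {m : ℕ} {f : Fin (m + 1) → ℝ → ℝ}
    (hf : ∀ i, IsYoungFunction (f i)) (i : Fin (m + 1)) (s : ℝ)
    (h0 : 0 < volume.real (orliczSublevel f s))
    (h2 : 0 < ∫ x in orliczSublevel f s, x i ^ 2) :
    (∫ x in orliczSublevel f s, x i ^ 4) * volume.real (orliczSublevel f s)
      ≤ 6 * (∫ x in orliczSublevel f s, x i ^ 2) ^ 2 := by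
  have hf' : ∀ j, IsYoungFunction (f (i.succAbove j)) := fun _ => hf _
  rw [setIntegral_orliczSublevel_pow hf i s (by decide)] at h2 ⊢
  rw [setIntegral_orliczSublevel_pow hf i s (by decide)]
  rw [← (integral_sliceVolume hf i s).2] at h0 ⊢
  refine fourth_moment_le (R := max 1 (s / f i 1)) (measurable_sliceVolume hf i s)
    (sliceVolume_nonneg i s) (fun t => sliceVolume_anti hf i s (by simp)) ?_
    (fun t => by simp [sliceVolume]) ?_ h0 h2
  · intro t ht
    refine volume_orliczSublevel_of_neg hf' ?_
    by_contra hh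
    exact absurd ((hf i).abs_le_of_map_le (s := s) (by linarith)) (not_le.2 ht)
  -- `s - f i |t|` is concave in `t`, and a nondecreasing log-concave function of it is log-concave.
  · intro x y μ hμ0 hμ1
    refine (volume_orliczSublevel_logConcave hf' hμ0 hμ1 _ _).trans
      (volumeReal_orliczSublevel_mono hf' ?_)
    have hz : |(1 - μ) * x + μ * y| ≤ (1 - μ) * |x| + μ * |y| := by
      refine (abs_add_le _ _).trans_eq ?_
      rw [abs_mul, abs_mul, abs_of_pos hμ0, abs_of_pos (by linarith : 0 < 1 - μ)]
    have := (hf i).abs_convexCombination_le hμ0.le hμ1.le hz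
    linarith

/-! ### Variance of the squared norm. -/

lemma generalizedOrliczBall_eq_preimage {n : ℕ} (f : Fin n → ℝ → ℝ) :
    generalizedOrliczBall f = WithLp.ofLp ⁻¹' orliczSublevel f 1 := rfl

/-- Coordinates identify the uniform distributions on a generalized Orlicz ball in
`EuclideanSpace` and in the plain product. -/
lemma measurePreserving_generalizedOrliczBall {n : ℕ} {f : Fin n → ℝ → ℝ}
    (hf : ∀ i, IsYoungFunction (f i)) :
    MeasurePreserving (WithLp.ofLp : EuclideanSpace ℝ (Fin n) → Fin n → ℝ)
      (volume.restrict (generalizedOrliczBall f)) (volume.restrict (orliczSublevel f 1)) := by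
  rw [generalizedOrliczBall_eq_preimage]
  exact (PiLp.volume_preserving_ofLp (Fin n)).restrict_preimage (measurableSet_orliczSublevel hf 1)

/-- The variance of the sum of the squares of the coordinates on a set of volume one with equal
second moments. -/
lemma variance_sum_sq_le {m : ℕ} {f : Fin (m + 1) → ℝ → ℝ} (hf : ∀ i, IsYoungFunction (f i))
    {L : ℝ} (hL : 0 < L) (hvol : volume (orliczSublevel f 1) = 1)
    (h2 : ∀ i, ∫ x in orliczSublevel f 1, x i ^ 2 = L ^ 2) :
    MemLp (fun x : Fin (m + 1) → ℝ => ∑ i, x i ^ 2) 2 (volume.restrict (orliczSublevel f 1)) ∧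
      variance (fun x : Fin (m + 1) → ℝ => ∑ i, x i ^ 2) (volume.restrict (orliczSublevel f 1))
        ≤ 5 * ((m + 1 : ℕ) * L ^ 4) := by
  set ν := volume.restrict (orliczSublevel f 1) with hν
  have : IsProbabilityMeasure ν := ⟨by simp [hν, hvol]⟩
  have hmem : ∀ i, MemLp (fun x : Fin (m + 1) → ℝ => x i ^ 2) 2 ν := by
    intro i
    refine MemLp.of_bound ((measurable_pi_apply i).pow_const 2).aestronglyMeasurable
      (max 1 (1 / f i 1) ^ 2) ?_
    refine (ae_restrict_iff' (measurableSet_orliczSublevel hf 1)).2 (.of_forall fun x hx => ?_)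
    rw [norm_pow, Real.norm_eq_abs]
    exact pow_le_pow_left₀ (abs_nonneg _) (abs_le_of_mem_orliczSublevel hf hx i) 2
  refine ⟨memLp_finsetSum _ fun i _ => hmem i, ?_⟩
  have hlint : ∀ i, ∫⁻ x, ENNReal.ofReal (x i ^ 2) ∂ν = ENNReal.ofReal (L ^ 2) := by
    intro i
    rw [← h2 i, ofReal_integral_eq_lintegral_ofReal ((hmem i).integrable (by simp))
      (.of_forall fun x => sq_nonneg _)]
  -- The fourth moment contributes at most `6 L⁴`, and the squared mean removes `L⁴`.
  have hdiag : ∀ i, cov[fun x : Fin (m + 1) → ℝ => x i ^ 2, fun x => x i ^ 2; ν]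
      ≤ 5 * L ^ 4 := by
    intro i
    have h4 := setIntegral_pow_four_mul_volume_le hf i 1 (by simp [measureReal_def, hvol])
      (by rw [h2 i]; positivity)
    rw [h2 i, measureReal_def, hvol, ENNReal.toReal_one, mul_one] at h4
    rw [covariance_eq_sub (hmem i) (hmem i), h2 i]
    have e : ∫ x, ((fun x : Fin (m + 1) → ℝ => x i ^ 2) * fun x : Fin (m + 1) → ℝ => x i ^ 2) x ∂ν
        = ∫ x : Fin (m + 1) → ℝ in orliczSublevel f 1, x i ^ 4 := by
      refine integral_congr_ae (.of_forall fun x => ?_)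
      simp only [Pi.mul_apply]; ring
    rw [e]
    linarith
  have hoff : ∀ i j, i ≠ j → cov[fun x : Fin (m + 1) → ℝ => x i ^ 2, fun x => x j ^ 2; ν] ≤ 0 := by
    intro i j hij
    have h := lintegral_sq_mul_sq_mul_volume_le hf hij 1
    rw [hvol, mul_one, hlint i, hlint j, ← ENNReal.ofReal_mul (sq_nonneg L)] at h
    rw [covariance_eq_sub (hmem i) (hmem j), h2 i, h2 j, sub_nonpos]
    simp only [Pi.mul_apply]
    rw [integral_eq_lintegral_of_nonneg_ae
        (.of_forall fun (x : Fin (m + 1) → ℝ) => mul_nonneg (sq_nonneg (x i)) (sq_nonneg (x j)))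
        ((hmem i).aestronglyMeasurable.mul (hmem j).aestronglyMeasurable)]
    refine ENNReal.toReal_le_of_le_ofReal (by positivity) (le_trans (le_of_eq ?_) h)
    exact lintegral_congr fun x => ENNReal.ofReal_mul (sq_nonneg _)
  rw [variance_fun_sum hmem]
  calc _ ≤ ∑ i : Fin (m + 1), ∑ j, if i = j then 5 * L ^ 4 else 0 := by
        refine Finset.sum_le_sum fun i _ => Finset.sum_le_sum fun j _ => ?_
        split_ifs with hij
        · subst hij; exact hdiag i
        · exact hoff i j hij
    _ = _ := by simp; ring

theorem theorem3p3 (n : ℕ) (hn : 1 ≤ n) (K : Set (EuclideanSpace ℝ (Fin n)))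
    (hK : IsGeneralizedOrliczBall K) (L : ℝ) (hL : IsIsotropic K L) :
    MemLp (fun x : EuclideanSpace ℝ (Fin n) => ‖x‖ ^ 2) 2 (volume.restrict K) ∧
      sigmaParam K L ≤ √5 := by
  obtain ⟨f, hf, rfl⟩ := hK
  obtain ⟨m, rfl⟩ := Nat.exists_eq_add_of_le' hn
  have hmp := measurePreserving_generalizedOrliczBall hf
  have hemb : MeasurableEmbedding (WithLp.ofLp : EuclideanSpace ℝ (Fin (m + 1)) → _) :=
    (MeasurableEquiv.toLp 2 (Fin (m + 1) → ℝ)).symm.measurableEmbedding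
  have hvol : volume (orliczSublevel f 1) = 1 := by
    have := hmp.measure_preimage MeasurableSet.univ.nullMeasurableSet
    simpa [hL.volume_eq_one] using this.symm
  -- Isotropy in the coordinate directions.
  have h2 : ∀ i, ∫ x in orliczSublevel f 1, x i ^ 2 = L ^ 2 := by
    intro i
    rw [← hmp.integral_comp hemb, ← hL.second_moment (EuclideanSpace.single i 1) (by simp)]
    simp [EuclideanSpace.inner_single_left]
  obtain ⟨hmem, hvar⟩ := variance_sum_sq_le hf hL.pos hvol h2
  have hnorm : (fun x : EuclideanSpace ℝ (Fin (m + 1)) => ‖x‖ ^ 2)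
      = (fun x : Fin (m + 1) → ℝ => ∑ i, x i ^ 2) ∘ WithLp.ofLp := by
    funext x
    simp [EuclideanSpace.norm_sq_eq]
  have hLpos := hL.pos
  refine ⟨by rw [hnorm]; exact hmem.comp_measurePreserving hmp, Real.sqrt_le_sqrt ?_⟩
  rw [hnorm, div_le_iff₀ (by positivity), ← variance_map _ hmp.aemeasurable, hmp.map_eq]
  · exact hvar
  · rw [hmp.map_eq]; exact hmem.aemeasurable
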